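/- Fix $0<p<1$. For a bounded operator $T$ on a complex Hilbert space put $s_j(T)=\inf\{\|T-R\|:\operatorname{rank}R\le j\}$ ($j\ge0$) and $\|T\|_{S_p}=\big(\sum_{j\ge0}s_j(T)^p\big)^{1/p}$; $S_p$ consists of the bounded operators with $\|T\|_{S_p}<\infty$. Complex $n\times n$ matrices are regarded as operators on $\mathbb C^n$ with the Euclidean norm, and infinite complex matrices $\{b_{jk}\}_{j,k\ge0}$ as operators on $\ell^2$ (when they define bounded ones). For a matrix $A$, finite or infinite, let $$\|A\|_{\mathfrak M_p}=\sup\{\|A\star B\|_{S_p}:\ B\in S_p,\ \|B\|_{S_p}\le1\},$$ where $B$ runs over matrices of the same size as $A$, $A\star B=\{a_{jk}b_{jk}\}$ is the entrywise product, and $\|A\star B\|_{S_p}=\infty$ if $A\star B\notin S_p$. Let $\chi_n$ be the $n\times n$ matrix with $(\chi_n)_{jk}=1$ if $j\le k$ and $0$ if $j>k$, and let $\Delta_n=\{(\Delta_n)_{jk}\}_{j,k\ge0}$ be the infinite Hankel matrix with $(\Delta_n)_{jk}=1$ if $j+k<n$ and $0$ if $j+k\ge n$. Let $\mathscr P_n$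 be the triangular projection on $n\times n$ matrices, which replaces the entries below the main diagonal by $0$ and leaves the others unchanged, and let $\|\mathscr P_n\|_{\mathcal B(S_p)}=\sup\{\|\mathscr P_nB\|_{S_p}:\ \|B\|_{S_p}\le1\}$. Then there are constants $c_p,C_p>0$, depending only on $p$, such that for every integer $n\ge1$ $$c_p\,n^{1/p-1}\ \le\ \|\mathscr P_n\|_{\mathcal B(S_p)}=\|\chi_n\|_{\mathfrak M_p}=\|\Delta_n\|_{\mathfrak M_p}\ \le\ C_p\,n^{1/p-1}.$$ -/

import Mathlib

open scoped ENNReal Matrix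

noncomputable section

/-- The `j`-th singular value (`j = 0, 1, 2, …`) of a bounded operator `T` between complex Hilbert
spaces: the distance in operator norm from `T` to the operators of rank at most `j`. -/
def singularValue {E F : Type*}
    [NormedAddCommGroup E] [InnerProductSpace ℂ E] [NormedAddCommGroup F] [InnerProductSpace ℂ F]
    (T : E →L[ℂ] F) (j : ℕ) : ℝ≥0∞ :=
  ⨅ (R : E →L[ℂ] F) (_ : LinearMap.rank (R : E →ₗ[ℂ] F) ≤ (j : Cardinal)), ‖T - R‖ₑ

/-- The Schatten–von Neumann (quasi-)norm `(∑ⱼ sⱼ(T)^p)^(1/p)` of a bounded operator, equal to `∞`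
exactly when `T` is not in the class `S_p`. -/
def schattenNormOp {E F : Type*}
    [NormedAddCommGroup E] [InnerProductSpace ℂ E] [NormedAddCommGroup F] [InnerProductSpace ℂ F]
    (p : ℝ) (T : E →L[ℂ] F) : ℝ≥0∞ :=
  (∑' j : ℕ, singularValue T j ^ p) ^ (1 / p)

/-- The bounded operator `T` on `ℓ²(ι)` has the matrix `A` in the standard basis:
the `j`-th coordinate of `T eₖ` is `A j k`. -/
def HasMatrix {ι : Type*} [DecidableEq ι]
    (T : lp (fun _ : ι => ℂ) 2 →L[ℂ] lp (fun _ : ι => ℂ) 2) (A : Matrix ι ι ℂ) : Prop :=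
  ∀ j k : ι, T (lp.single 2 k (1 : ℂ)) j = A j k

/-- The Schatten–von Neumann (quasi-)norm of a finite or infinite matrix: that of the bounded
operator on `ℓ²(ι)` with this matrix (there is at most one), and `∞` if there is no such operator.
The matrix belongs to `S_p` exactly when this is finite. -/
def schattenNorm {ι : Type*} [DecidableEq ι] (p : ℝ) (A : Matrix ι ι ℂ) : ℝ≥0∞ :=
  ⨅ (T : lp (fun _ : ι => ℂ) 2 →L[ℂ] lp (fun _ : ι => ℂ) 2) (_ : HasMatrix T A),
    schattenNormOp p T

/-- The `p`-norm of a transformer on the class `S_p` of matrices indexed by `ι`: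
the supremum of `‖𝒯 B‖` over the unit ball of `S_p`. -/
def transformerNorm {ι : Type*} [DecidableEq ι] (p : ℝ)
    (𝒯 : Matrix ι ι ℂ →ₗ[ℂ] Matrix ι ι ℂ) : ℝ≥0∞ :=
  ⨆ (B : Matrix ι ι ℂ) (_ : schattenNorm p B ≤ 1), schattenNorm p (𝒯 B)

/-- The Schur multiplier (quasi-)norm of a finite or infinite matrix: the supremum of the `S_p`
norms of the Schur–Hadamard products `A ⊙ B` over the unit ball of `S_p`. -/
def schurMultiplierNorm {ι : Type*} [DecidableEq ι] (p : ℝ) (A : Matrix ι ι ℂ) : ℝ≥0∞ :=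
  ⨆ (B : Matrix ι ι ℂ) (_ : schattenNorm p B ≤ 1), schattenNorm p (A ⊙ B)

/-- The `n × n` upper triangular matrix `χₙ` with ones on and above the diagonal. -/
def chiMatrix (n : ℕ) : Matrix (Fin n) (Fin n) ℂ :=
  Matrix.of fun j k => if j ≤ k then 1 else 0

/-- The infinite Hankel matrix `Δₙ` with ones where `j + k < n` and zeros elsewhere. -/
def deltaMatrix (n : ℕ) : Matrix ℕ ℕ ℂ :=
  Matrix.of fun j k => if j + k < n then 1 else 0

/-- The triangular projection `𝒫ₙ`: it annihilates the entries below the main diagonal and leaves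
the others unchanged. -/
def triangularProjection (n : ℕ) :
    Matrix (Fin n) (Fin n) ℂ →ₗ[ℂ] Matrix (Fin n) (Fin n) ℂ where
  toFun A := Matrix.of fun j k => if j ≤ k then A j k else 0
  map_add' A B := by
    ext j k
    by_cases h : j ≤ k <;> simp [h]
  map_smul' c A := by
    ext j k
    by_cases h : j ≤ k <;> simp [h]

end

/-! ### Singular value decomposition and eigenvalue comparison in finite dimension. -/

section FiniteDimensional

variable {E : Type*} [NormedAddCommGroup E] [InnerProductSpace ℂ E] {n : ℕ}

/-! The triangular projection is Schur multiplication by `chiMatrix n`. Reversing the columns turns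
`chiMatrix n` into the only nonzero block of `deltaMatrix n`, and neither permuting coordinates nor
padding by zeros changes a Schatten quasi-norm. This gives the two equalities, and only `chiMatrix
n` has to be estimated.

Lower bound: the matrix with all entries `1/n` is a rank one projection, hence in the unit ball. Its
product with `chiMatrix n` is `χₙ/n`. Since `χₙ⁻¹` is the identity minus a shift, of norm at most
`2`, all `n` singular values of `χₙ/n` are at least `1/(2n)`, and the quasi-norm is at least
`n^(1/p) / (2n)`.

Upper bound: put `q = 2^(1-p) > 1` and let `D_t A` be the part of `A` in the diagonal blocks of size
`2^t`. Halving the blocks is the average of a matrix and its conjugate by signs, so by the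
`p`-triangle inequality it multiplies `‖·‖^p` by at most `2 · 2^(-p) = q`. The upper triangle of a
block consists of the upper triangles of its two halves and an off-diagonal corner, which is a
compression. For `n ≤ 2^m` and `‖A‖ ≤ 1`, summing over scales gives `‖χₙ ⊙ A‖^p ≤ ∑_{t ≤ m}
q^(m-t)`, of order `q^m`, that is `n^(1-p)`.

The analytic ingredient is the `p`-triangle inequality `tsum_singularValue_add_le`. It follows from
`IsSVD.sum_rpow_le`: `∑ σ_k^p` is at most `∑ (‖x_i‖‖y_i‖)^p` for any decomposition into rank one
operators. The polar decomposition and Weyl monotonicity reduce this to positive rank one sums,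
where Hölder's inequality applies. -/

/-- A nonzero vector annihilated by a linear map of rank at most `j` in the span of the first `j + 1`
vectors of an orthonormal basis. -/
theorem exists_ne_zero_of_rank_le (e : OrthonormalBasis (Fin n) ℂ E) (j : Fin n)
    {F : Type*} [AddCommGroup F] [Module ℂ F] (R : E →ₗ[ℂ] F)
    (hR : LinearMap.rank R ≤ ((j : ℕ) : Cardinal)) :
    ∃ v : E, v ≠ 0 ∧ R v = 0 ∧ ∀ i, j < i → inner ℂ (e i) v = 0 := by
  have : FiniteDimensional ℂ E := e.toBasis.finiteDimensional_of_finite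
  have hE : Module.finrank ℂ E = n := by
    simpa using Module.finrank_eq_card_basis e.toBasis
  -- Dimension count: the target has dimension at most `j + (n - 1 - j) < n`, so `φ` has a kernel.
  let φ : E →ₗ[ℂ] (LinearMap.range R) × ({i : Fin n // j < i} → ℂ) :=
    R.rangeRestrict.prod (LinearMap.pi fun i => (innerSL ℂ (e i)).toLinearMap)
  have hrange : Module.finrank ℂ (LinearMap.range R) ≤ j := by
    have := Module.finrank_le_of_rank_le (R := ℂ) (M := LinearMap.range R) (n := j) hR
    exact this
  have hcard : Fintype.card {i : Fin n // j < i} = n - 1 - j := by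
    rw [Fintype.card_subtype]
    have : (Finset.univ.filter fun i : Fin n => j < i) = Finset.Ioi j := by ext; simp
    rw [this, Fin.card_Ioi]
  have hlt : Module.finrank ℂ ((LinearMap.range R) × ({i : Fin n // j < i} → ℂ)) <
      Module.finrank ℂ E := by
    rw [Module.finrank_prod, Module.finrank_fintype_fun_eq_card, hcard, hE]
    have := j.2
    omega
  obtain ⟨v, hv, hv0⟩ := (Submodule.ne_bot_iff _).1 (LinearMap.ker_ne_bot_of_finrank_lt (f := φ) hlt)
  have h := LinearMap.mem_ker.1 hv
  refine ⟨v, hv0, ?_, fun i hi => ?_⟩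
  · have := congrArg (fun w => ((w.1 : LinearMap.range R) : F)) h
    simpa [φ] using this
  · have := congrArg (fun w => w.2 ⟨i, hi⟩) h
    simpa [φ] using this

theorem norm_sq_eq_sum (e : OrthonormalBasis (Fin n) ℂ E) (v : E) :
    ‖v‖ ^ 2 = ∑ i, ‖inner ℂ (e i) v‖ ^ 2 := (e.sum_sq_norm_inner_right v).symm

/-- Comparison of eigenvalues of two forms, one dominated by the other. -/
theorem le_of_forall_sum_le (e g : OrthonormalBasis (Fin n) ℂ E) {c l : Fin n → ℝ}
    (hc : Antitone c) (hl : Antitone l)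
    (h : ∀ v, ∑ k, c k * ‖inner ℂ (e k) v‖ ^ 2 ≤ ∑ k, l k * ‖inner ℂ (g k) v‖ ^ 2)
    (j : Fin n) : c j ≤ l j := by
  -- Courant–Fischer: some nonzero `v` lies in the span of `e 0, …, e j` and is orthogonal to `g i`
  -- for `i < j`. There the first form is at least `c j * ‖v‖ ^ 2` and the second at most `l j * ‖v‖
  -- ^ 2`.
  let R : E →ₗ[ℂ] ({i : Fin n // i < j} → ℂ) :=
    LinearMap.pi fun i => (innerSL ℂ (g i)).toLinearMap
  have hR : LinearMap.rank R ≤ ((j : ℕ) : Cardinal) := by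
    refine (Submodule.rank_le _).trans ?_
    rw [rank_fun', Nat.cast_le, Fintype.card_subtype]
    have : (Finset.univ.filter fun i : Fin n => i < j) = Finset.Iio j := by ext; simp
    rw [this, Fin.card_Iio]
  obtain ⟨v, hv0, hRv, hv⟩ := exists_ne_zero_of_rank_le e j R hR
  have hg : ∀ i, i < j → inner ℂ (g i) v = 0 := fun i hi => by
    simpa [R] using congrFun hRv ⟨i, hi⟩
  have h1 : c j * ‖v‖ ^ 2 ≤ ∑ k, c k * ‖inner ℂ (e k) v‖ ^ 2 := by
    rw [norm_sq_eq_sum e v, Finset.mul_sum]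
    refine Finset.sum_le_sum fun k _ => ?_
    rcases le_or_gt k j with hk | hk
    · exact mul_le_mul_of_nonneg_right (hc hk) (by positivity)
    · simp [hv k hk]
  have h2 : ∑ k, l k * ‖inner ℂ (g k) v‖ ^ 2 ≤ l j * ‖v‖ ^ 2 := by
    rw [norm_sq_eq_sum g v, Finset.mul_sum]
    refine Finset.sum_le_sum fun k _ => ?_
    rcases le_or_gt j k with hk | hk
    · exact mul_le_mul_of_nonneg_right (hl hk) (by positivity)
    · simp [hg k hk]
  have hvpos : 0 < ‖v‖ ^ 2 := by positivity
  exact le_of_mul_le_mul_right (h1.trans ((h v).trans h2)) hvpos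

/-- The data of a singular value decomposition of `T`: the singular values `σ` in decreasing order
and the right singular vectors `e`. -/
structure IsSVD (T : E →L[ℂ] E) (σ : Fin n → ℝ) (e : OrthonormalBasis (Fin n) ℂ E) : Prop where
  antitone : Antitone σ
  nonneg : ∀ i, 0 ≤ σ i
  inner_map : ∀ i j, inner ℂ (T (e i)) (T (e j)) = if i = j then ((σ i ^ 2 : ℝ) : ℂ) else 0

theorem exists_isSVD [FiniteDimensional ℂ E] (hn : Module.finrank ℂ E = n) (T : E →L[ℂ] E) :
    ∃ (σ : Fin n → ℝ) (e : OrthonormalBasis (Fin n) ℂ E), IsSVD T σ e := by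
  let A : E →ₗ[ℂ] E := T
  let S := A.isSymmetric_adjoint_comp_self
  refine ⟨fun i => A.singularValues i, S.eigenvectorBasis hn, ?_, ?_, ?_⟩
  · exact fun i j hij => A.singularValues_antitone hij
  · exact fun i => A.singularValues_nonneg i
  · intro i j
    have h : inner ℂ (A (S.eigenvectorBasis hn i)) (A (S.eigenvectorBasis hn j)) =
        inner ℂ (S.eigenvectorBasis hn i)
          ((LinearMap.adjoint A ∘ₗ A) (S.eigenvectorBasis hn j)) := by
      rw [LinearMap.comp_apply, LinearMap.adjoint_inner_right]
    change inner ℂ (A (S.eigenvectorBasis hn i)) (A (S.eigenvectorBasis hn j)) = _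
    rw [h, S.apply_eigenvectorBasis, inner_smul_right,
      orthonormal_iff_ite.1 (S.eigenvectorBasis hn).orthonormal i j, A.sq_singularValues_fin hn i]
    split_ifs with hij
    · subst hij; simp
    · simp

variable {T : E →L[ℂ] E} {σ : Fin n → ℝ} {e : OrthonormalBasis (Fin n) ℂ E}

namespace IsSVD

theorem norm_map_basis (h : IsSVD T σ e) (i : Fin n) : ‖T (e i)‖ = σ i := by
  have := h.inner_map i i
  rw [if_pos rfl, inner_self_eq_norm_sq_to_K] at this
  have h2 : ‖T (e i)‖ ^ 2 = σ i ^ 2 := Complex.ofReal_injective (by simpa using this)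
  exact (pow_left_inj₀ (norm_nonneg _) (h.nonneg i) two_ne_zero).1 h2

theorem norm_sq_sum_smul (h : IsSVD T σ e) (a : Fin n → ℂ) :
    ‖∑ i, a i • T (e i)‖ ^ 2 = ∑ i, σ i ^ 2 * ‖a i‖ ^ 2 := by
  have : ((‖∑ i, a i • T (e i)‖ ^ 2 : ℝ) : ℂ) = ((∑ i, σ i ^ 2 * ‖a i‖ ^ 2 : ℝ) : ℂ) := by
    push_cast
    have h3 := inner_self_eq_norm_sq_to_K (𝕜 := ℂ) (∑ i, a i • T (e i))
    refine h3.symm.trans ?_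
    rw [sum_inner]
    refine Finset.sum_congr rfl fun i _ => ?_
    rw [inner_sum, Finset.sum_eq_single i]
    · rw [inner_smul_left, inner_smul_right, h.inner_map, if_pos rfl, ← mul_assoc,
        Complex.conj_mul']
      push_cast; ring
    · intro j _ hj
      rw [inner_smul_left, inner_smul_right, h.inner_map, if_neg (Ne.symm hj)]; simp
    · simp
  exact_mod_cast this

theorem map_eq_sum (T : E →L[ℂ] E) (e : OrthonormalBasis (Fin n) ℂ E) (v : E) :
    T v = ∑ i, (inner ℂ (e i) v) • T (e i) := by
  conv_lhs => rw [← e.sum_repr' v]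
  simp

theorem norm_map_sq (h : IsSVD T σ e) (v : E) :
    ‖T v‖ ^ 2 = ∑ i, σ i ^ 2 * ‖inner ℂ (e i) v‖ ^ 2 := by
  rw [map_eq_sum T e v, h.norm_sq_sum_smul]

/-- An operator of rank at most `j` kills a nonzero vector in the span of `e 0, …, e j`, and `T`
shrinks no vector of that span by more than the factor `σ j`. -/
theorem le_singularValue (h : IsSVD T σ e) (j : Fin n) :
    ENNReal.ofReal (σ j) ≤ singularValue T j := by
  refine le_iInf₂ fun R hR => ?_
  obtain ⟨v, hv0, hRv, hv⟩ := exists_ne_zero_of_rank_le e j (R : E →ₗ[ℂ] E) hR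
  rw [← ofReal_norm]
  refine ENNReal.ofReal_le_ofReal ?_
  have h1 : (σ j * ‖v‖) ^ 2 ≤ ‖T v‖ ^ 2 := by
    rw [h.norm_map_sq, mul_pow, norm_sq_eq_sum e v, Finset.mul_sum]
    refine Finset.sum_le_sum fun k _ => ?_
    rcases le_or_gt k j with hk | hk
    · have := h.antitone hk
      have := h.nonneg j
      gcongr
    · simp [hv k hk]
  have h2 := le_of_sq_le_sq h1 (norm_nonneg _)
  have h3 : T v = (T - R) v := by
    have : R v = 0 := hRv
    simp [this]
  rw [h3] at h2
  exact le_of_mul_le_mul_right (h2.trans ((T - R).le_opNorm v)) (norm_pos_iff.2 hv0)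

/-- The competitor is the decomposition truncated after `j` terms. A free bound `s` also covers `j ≥
n`, where `s = 0` is admissible. -/
theorem singularValue_le (h : IsSVD T σ e) (j : ℕ) (s : ℝ) (hs : 0 ≤ s)
    (hj : ∀ i : Fin n, j ≤ i → σ i ≤ s) : singularValue T j ≤ ENNReal.ofReal s := by
  classical
  let I : Finset (Fin n) := Finset.univ.filter fun i => (i : ℕ) < j
  let R : E →L[ℂ] E := ∑ i ∈ I, (innerSL ℂ (e i)).smulRight (T (e i))
  have hRv : ∀ v, R v = ∑ i ∈ I, inner ℂ (e i) v • T (e i) := fun v => by simp [R]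
  have hR : LinearMap.rank (R : E →ₗ[ℂ] E) ≤ (j : Cardinal) := by
    have hle : LinearMap.range (R : E →ₗ[ℂ] E) ≤
        Submodule.span ℂ ((I.image fun i => T (e i) : Finset E) : Set E) := by
      rintro _ ⟨v, rfl⟩
      change R v ∈ _
      rw [hRv]
      refine Submodule.sum_mem _ fun i hi => Submodule.smul_mem _ _ (Submodule.subset_span ?_)
      simpa using ⟨i, hi, rfl⟩
    refine (Submodule.rank_mono hle).trans ((rank_span_finset_le _).trans ?_)
    rw [Nat.cast_le]
    refine Finset.card_image_le.trans ?_
    have : I.card ≤ (Finset.range j).card :=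
      Finset.card_le_card_of_injOn (fun i => (i : ℕ)) (fun i hi => by simpa [I] using hi)
        (fun a _ b _ hab => Fin.ext hab)
    simpa using this
  refine (iInf₂_le R hR).trans ?_
  rw [← ofReal_norm]
  refine ENNReal.ofReal_le_ofReal (ContinuousLinearMap.opNorm_le_bound _ hs fun v => ?_)
  have h1 : (T - R) v = ∑ i : Fin n, (if (i : ℕ) < j then 0 else inner ℂ (e i) v) • T (e i) := by
    rw [sub_apply, hRv, map_eq_sum T e v, Finset.sum_filter, ← Finset.sum_sub_distrib]
    refine Finset.sum_congr rfl fun i _ => ?_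
    split_ifs <;> simp
  refine le_of_sq_le_sq ?_ (by positivity)
  rw [h1, h.norm_sq_sum_smul, mul_pow, norm_sq_eq_sum e v, Finset.mul_sum]
  refine Finset.sum_le_sum fun k _ => ?_
  split_ifs with hk
  · simp; positivity
  · have := hj k (not_lt.1 hk)
    have := h.nonneg k
    gcongr

theorem tsum_singularValue (h : IsSVD T σ e) {p : ℝ} (hp : 0 < p) :
    ∑' j, singularValue T j ^ p = ENNReal.ofReal (∑ j, σ j ^ p) := by
  have h0 : ∀ j ∉ Finset.range n, singularValue T j ^ p = 0 := by
    intro j hj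
    have hj' : n ≤ j := by simpa using hj
    have := h.singularValue_le j 0 le_rfl fun i hi => absurd i.2 (by omega)
    simp only [ENNReal.ofReal_zero, nonpos_iff_eq_zero] at this
    rw [this, ENNReal.zero_rpow_of_pos hp]
  rw [tsum_eq_sum h0, ← Fin.sum_univ_eq_sum_range (fun j => singularValue T j ^ p) n,
    ENNReal.ofReal_sum_of_nonneg fun i _ => Real.rpow_nonneg (h.nonneg i) p]
  refine Finset.sum_congr rfl fun j _ => ?_
  rw [le_antisymm (h.singularValue_le j (σ j) (h.nonneg j) fun i hi => h.antitone hi)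
    (h.le_singularValue j), ENNReal.ofReal_rpow_of_nonneg (h.nonneg j) hp.le]

end IsSVD

end FiniteDimensional

/-! ### The `p`-triangle inequality through rank one decompositions. -/

section Atomic

variable {E : Type*} [NormedAddCommGroup E] [InnerProductSpace ℂ E] {n : ℕ}

/-- The trace of the `p`-th power of a sum of positive rank one operators, `p ≤ 1`, is at most the
sum of the traces. -/
theorem sum_rpow_le_of_eq {κ : Type*} (s : Finset κ) (z : κ → E)
    (g : OrthonormalBasis (Fin n) ℂ E) (l : Fin n → ℝ) (hl : ∀ k, 0 ≤ l k)
    (h : ∀ v, ∑ k, l k * ‖inner ℂ (g k) v‖ ^ 2 = ∑ i ∈ s, ‖inner ℂ (z i) v‖ ^ 2)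
    {p : ℝ} (hp0 : 0 < p) (hp1 : p < 1) :
    ∑ k, l k ^ p ≤ ∑ i ∈ s, (‖z i‖ ^ 2) ^ p := by
  have hlk : ∀ k, l k = ∑ i ∈ s, ‖inner ℂ (g k) (z i)‖ ^ 2 := by
    intro k
    have := h (g k)
    rw [Finset.sum_eq_single k] at this
    · simpa [norm_inner_symm (g k)] using this
    · intro b _ hb
      rw [orthonormal_iff_ite.1 g.orthonormal b k, if_neg hb]; simp
    · simp
  have hzero : ∀ i ∈ s, ∀ k, l k = 0 → ‖inner ℂ (g k) (z i)‖ ^ 2 = 0 := by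
    intro i hi k hk
    rw [hlk k, Finset.sum_eq_zero_iff_of_nonneg fun _ _ => by positivity] at hk
    exact hk i hi
  -- With `P = ∑ z_i ⊗ z_i`, this says `⟨P⁻¹ z_i, z_i⟩ ≤ 1`. The convention `0⁻¹ = 0` makes `P⁻¹`
  -- the pseudo-inverse. For `u = P⁻¹ z_i` the value `q` equals both `⟨z_i, u⟩` and `⟨P u, u⟩`,
  -- whence `q ^ 2 ≤ q`.
  have hone : ∀ i ∈ s, ∑ k, (l k)⁻¹ * ‖inner ℂ (g k) (z i)‖ ^ 2 ≤ 1 := by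
    intro i hi
    set q := ∑ k, (l k)⁻¹ * ‖inner ℂ (g k) (z i)‖ ^ 2 with hq
    let u : E := ∑ k, (((l k)⁻¹ : ℝ) * inner ℂ (g k) (z i) : ℂ) • g k
    have hgu : ∀ k, inner ℂ (g k) u = (((l k)⁻¹ : ℝ) * inner ℂ (g k) (z i) : ℂ) :=
      fun k => g.orthonormal.inner_right_fintype _ k
    have h1 : ∑ k, l k * ‖inner ℂ (g k) u‖ ^ 2 = q := by
      refine Finset.sum_congr rfl fun k _ => ?_
      rw [hgu, norm_mul, Complex.norm_real, Real.norm_of_nonneg (inv_nonneg.2 (hl k))]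
      rcases eq_or_ne (l k) 0 with h0 | h0
      · simp [h0]
      · field_simp
    have h2 : inner ℂ (z i) u = (q : ℂ) := by
      simp only [u, inner_sum, inner_smul_right, hq, Complex.ofReal_sum]
      refine Finset.sum_congr rfl fun k _ => ?_
      rw [← inner_conj_symm (z i) (g k), mul_assoc, Complex.mul_conj']
      push_cast; ring
    have hq0 : 0 ≤ q := Finset.sum_nonneg fun k _ =>
      mul_nonneg (inv_nonneg.2 (hl k)) (by positivity)
    have h3 : q ^ 2 ≤ q := by
      calc q ^ 2 = ‖inner ℂ (z i) u‖ ^ 2 := by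
            rw [h2, Complex.norm_real, Real.norm_of_nonneg hq0]
        _ ≤ ∑ i ∈ s, ‖inner ℂ (z i) u‖ ^ 2 :=
            Finset.single_le_sum (f := fun i => ‖inner ℂ (z i) u‖ ^ 2)
              (fun _ _ => by positivity) hi
        _ = q := by rw [← h u, h1]
    nlinarith
  -- Hölder with exponents `1/(1-p)` and `1/p` after writing `l^(p-1) a = (a/l)^(1-p) a^p`; the
  -- first factor is bounded by `hone`.
  have hterm : ∀ i ∈ s, ∑ k, l k ^ (p - 1) * ‖inner ℂ (g k) (z i)‖ ^ 2 ≤ (‖z i‖ ^ 2) ^ p := by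
    intro i hi
    have hconj : (1 / (1 - p)).HolderConjugate (1 / p) := by
      rw [Real.holderConjugate_iff]
      constructor
      · rw [lt_div_iff₀ (by linarith)]; linarith
      · simp
    have hH := Real.inner_le_Lp_mul_Lq_of_nonneg Finset.univ hconj
      (f := fun k => ((l k)⁻¹ * ‖inner ℂ (g k) (z i)‖ ^ 2) ^ (1 - p))
      (g := fun k => (‖inner ℂ (g k) (z i)‖ ^ 2) ^ p)
      (fun k _ => Real.rpow_nonneg (mul_nonneg (inv_nonneg.2 (hl k)) (by positivity)) _)
      (fun k _ => by positivity)
    have e1 : ∀ k, (((l k)⁻¹ * ‖inner ℂ (g k) (z i)‖ ^ 2) ^ (1 - p)) ^ (1 / (1 - p)) =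
        (l k)⁻¹ * ‖inner ℂ (g k) (z i)‖ ^ 2 := fun k => by
      rw [← Real.rpow_mul (mul_nonneg (inv_nonneg.2 (hl k)) (by positivity)),
        mul_one_div_cancel (by linarith), Real.rpow_one]
    have e2 : ∀ k, ((‖inner ℂ (g k) (z i)‖ ^ 2) ^ p) ^ (1 / p) =
        ‖inner ℂ (g k) (z i)‖ ^ 2 := fun k => by
      rw [← Real.rpow_mul (by positivity), mul_one_div_cancel hp0.ne', Real.rpow_one]
    simp only [e1, e2, one_div_one_div] at hH
    calc ∑ k, l k ^ (p - 1) * ‖inner ℂ (g k) (z i)‖ ^ 2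
        = ∑ k, ((l k)⁻¹ * ‖inner ℂ (g k) (z i)‖ ^ 2) ^ (1 - p) *
            (‖inner ℂ (g k) (z i)‖ ^ 2) ^ p := by
          refine Finset.sum_congr rfl fun k _ => ?_
          rcases eq_or_ne (l k) 0 with h0 | h0
          · rw [hzero i hi k h0, Real.zero_rpow hp0.ne']; simp
          · have hpos : 0 < l k := lt_of_le_of_ne (hl k) (Ne.symm h0)
            have hb : 0 ≤ ‖inner ℂ (g k) (z i)‖ ^ 2 := by positivity
            rw [Real.mul_rpow (by positivity) hb, mul_assoc,
              ← Real.rpow_add_of_nonneg hb (by linarith) hp0.le, sub_add_cancel, Real.rpow_one,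
              Real.inv_rpow hpos.le, ← Real.rpow_neg hpos.le, neg_sub]
      _ ≤ _ := hH
      _ ≤ 1 ^ (1 - p) * (‖z i‖ ^ 2) ^ p := by
          rw [norm_sq_eq_sum g (z i)]
          refine mul_le_mul_of_nonneg_right ?_ (Real.rpow_nonneg (Finset.sum_nonneg fun _ _ =>
            by positivity) _)
          exact Real.rpow_le_rpow (Finset.sum_nonneg fun k _ =>
            mul_nonneg (inv_nonneg.2 (hl k)) (by positivity)) (hone i hi) (by linarith)
      _ = _ := by rw [Real.one_rpow, one_mul]
  -- The trace of `P^p = P^(p-1) P` is expanded as `∑ ⟨P^(p-1) z_i, z_i⟩`.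
  calc ∑ k, l k ^ p = ∑ k, ∑ i ∈ s, l k ^ (p - 1) * ‖inner ℂ (g k) (z i)‖ ^ 2 := by
        refine Finset.sum_congr rfl fun k _ => ?_
        rw [← Finset.mul_sum, ← hlk]
        rcases eq_or_ne (l k) 0 with h0 | h0
        · rw [h0, Real.zero_rpow hp0.ne', mul_zero]
        · rw [← Real.rpow_add_one h0, sub_add_cancel]
    _ = ∑ i ∈ s, ∑ k, l k ^ (p - 1) * ‖inner ℂ (g k) (z i)‖ ^ 2 := Finset.sum_comm
    _ ≤ _ := Finset.sum_le_sum hterm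

/-- The same for an operator with eigenvalues `c` that is dominated by the sum. -/
theorem sum_rpow_le_of_le {κ : Type*} (s : Finset κ) (z : κ → E)
    (e : OrthonormalBasis (Fin n) ℂ E) (c : Fin n → ℝ) (hc : ∀ k, 0 ≤ c k) (hanti : Antitone c)
    (h : ∀ v, ∑ k, c k * ‖inner ℂ (e k) v‖ ^ 2 ≤ ∑ i ∈ s, ‖inner ℂ (z i) v‖ ^ 2)
    {p : ℝ} (hp0 : 0 < p) (hp1 : p < 1) :
    ∑ k, c k ^ p ≤ ∑ i ∈ s, (‖z i‖ ^ 2) ^ p := by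
  have : FiniteDimensional ℂ E := e.toBasis.finiteDimensional_of_finite
  have hn : Module.finrank ℂ E = n := by
    simpa using Module.finrank_eq_card_basis e.toBasis
  let P : E →ₗ[ℂ] E := ∑ i ∈ s, ((innerSL ℂ (z i)).smulRight (z i) : E →L[ℂ] E).toLinearMap
  have hPv : ∀ v, P v = ∑ i ∈ s, (inner ℂ (z i) v) • z i := fun v => by simp [P]
  have hS : P.IsSymmetric := by
    intro v w
    rw [hPv, hPv, sum_inner, inner_sum]
    refine Finset.sum_congr rfl fun i _ => ?_
    rw [inner_smul_left, inner_smul_right, inner_conj_symm, mul_comm]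
  have hPi : ∀ v, inner ℂ v (P v) = ((∑ i ∈ s, ‖inner ℂ (z i) v‖ ^ 2 : ℝ) : ℂ) := by
    intro v
    rw [hPv, inner_sum]
    push_cast
    refine Finset.sum_congr rfl fun i _ => ?_
    rw [inner_smul_right, ← inner_conj_symm v (z i), Complex.mul_conj']
  have hform : ∀ v, ∑ k, hS.eigenvalues hn k * ‖inner ℂ (hS.eigenvectorBasis hn k) v‖ ^ 2 =
      ∑ i ∈ s, ‖inner ℂ (z i) v‖ ^ 2 := by
    intro v
    have h1 := hPi v
    rw [← (hS.eigenvectorBasis hn).sum_inner_mul_inner v (P v)] at h1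
    refine Complex.ofReal_injective (Eq.trans ?_ h1)
    push_cast
    refine Finset.sum_congr rfl fun k _ => ?_
    rw [← hS, hS.apply_eigenvectorBasis, inner_smul_left, ← inner_conj_symm v, mul_left_comm,
      Complex.conj_mul']
    simp
  have hnn : ∀ k, 0 ≤ hS.eigenvalues hn k := by
    intro k
    have h1 := hform (hS.eigenvectorBasis hn k)
    rw [Finset.sum_eq_single k] at h1
    · simp only [OrthonormalBasis.norm_eq_one, inner_self_eq_norm_sq_to_K] at h1
      have : 0 ≤ ∑ i ∈ s, ‖inner ℂ (z i) (hS.eigenvectorBasis hn k)‖ ^ 2 :=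
        Finset.sum_nonneg fun _ _ => by positivity
      simpa [← h1] using this
    · intro b _ hb
      rw [orthonormal_iff_ite.1 (hS.eigenvectorBasis hn).orthonormal b k, if_neg hb]; simp
    · simp
  refine le_trans (Finset.sum_le_sum fun k _ => Real.rpow_le_rpow (hc k) ?_ hp0.le)
    (sum_rpow_le_of_eq s z (hS.eigenvectorBasis hn) (hS.eigenvalues hn) hnn hform hp0 hp1)
  exact le_of_forall_sum_le e (hS.eigenvectorBasis hn) hanti (hS.eigenvalues_antitone hn)
    (fun v => (h v).trans (hform v).ge) k

/-- The real part of a rank one operator is dominated by a positive rank one operator of no larger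
norm. -/
theorem exists_re_inner_mul_inner_le (x y : E) :
    ∃ z : E, ‖z‖ ^ 2 ≤ ‖x‖ * ‖y‖ ∧
      ∀ v, (inner ℂ v x * inner ℂ y v).re ≤ ‖inner ℂ z v‖ ^ 2 := by
  rcases eq_or_ne x 0 with rfl | hx
  · exact ⟨0, by simp, by simp⟩
  rcases eq_or_ne y 0 with rfl | hy
  · exact ⟨0, by simp, by simp⟩
  have hx' := norm_pos_iff.2 hx
  have hy' := norm_pos_iff.2 hy
  -- This `t` balances `‖t x‖ = ‖t⁻¹ y‖`. With `z = (t x + t⁻¹ y) / 2`, the inequality is `4 Re(ᾱβ)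
  -- ≤ |α + β|²` for `α = t⟨x, v⟩` and `β = t⁻¹⟨y, v⟩`.
  set t : ℝ := √(‖y‖ / ‖x‖) with ht
  have ht0 : 0 < t := Real.sqrt_pos.2 (by positivity)
  have ht2 : t ^ 2 = ‖y‖ / ‖x‖ := Real.sq_sqrt (by positivity)
  refine ⟨((1 / 2 : ℝ) : ℂ) • (((t : ℝ) : ℂ) • x + ((t⁻¹ : ℝ) : ℂ) • y), ?_, fun v => ?_⟩
  · have h1 : ‖((t : ℝ) : ℂ) • x + ((t⁻¹ : ℝ) : ℂ) • y‖ ≤ t * ‖x‖ + t⁻¹ * ‖y‖ := by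
      refine (norm_add_le _ _).trans_eq ?_
      rw [norm_smul, norm_smul, Complex.norm_real, Complex.norm_real, Real.norm_of_nonneg ht0.le,
        Real.norm_of_nonneg (by positivity)]
    have h2 : t⁻¹ * ‖y‖ = t * ‖x‖ := by
      have : ‖y‖ = t ^ 2 * ‖x‖ := by rw [ht2]; field_simp
      rw [this]; field_simp
    have h3 : ‖x‖ * ‖y‖ = (t * ‖x‖) ^ 2 := by
      rw [mul_pow, ht2]; field_simp
    rw [norm_smul, Complex.norm_real, Real.norm_of_nonneg (by norm_num), h3]
    refine pow_le_pow_left₀ (by positivity) ?_ 2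
    rw [h2] at h1
    linarith
  · set a : ℂ := inner ℂ x v
    set b : ℂ := inner ℂ y v
    have h1 : inner ℂ v x = (starRingEnd ℂ) a := (inner_conj_symm v x).symm
    have h2 : inner ℂ (((1 / 2 : ℝ) : ℂ) • (((t : ℝ) : ℂ) • x + ((t⁻¹ : ℝ) : ℂ) • y)) v =
        ((1 / 2 : ℝ) : ℂ) * ((t : ℂ) * a + ((t⁻¹ : ℝ) : ℂ) * b) := by
      rw [inner_smul_left, inner_add_left, inner_smul_left, inner_smul_left]
      simp only [Complex.conj_ofReal, a, b]
    rw [h1, h2, ← Complex.normSq_eq_norm_sq, Complex.normSq_apply]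
    simp only [Complex.mul_re, Complex.mul_im, Complex.add_re, Complex.add_im, Complex.ofReal_re,
      Complex.ofReal_im, Complex.conj_re, Complex.conj_im]
    have ht1 : t * t⁻¹ = 1 := mul_inv_cancel₀ ht0.ne'
    have e1 : a.re * b.re = (t * a.re) * (t⁻¹ * b.re) := by
      rw [mul_mul_mul_comm, ht1, one_mul]
    have e2 : a.im * b.im = (t * a.im) * (t⁻¹ * b.im) := by
      rw [mul_mul_mul_comm, ht1, one_mul]
    nlinarith [sq_nonneg (t * a.re - t⁻¹ * b.re), sq_nonneg (t * a.im - t⁻¹ * b.im)]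

/-- If `T` is a finite sum of rank one operators, then the sum of the `p`-th powers of its singular
values is at most that of the norms of the rank one operators, `p < 1`. -/
theorem IsSVD.sum_rpow_le {T : E →L[ℂ] E} {σ : Fin n → ℝ} {e : OrthonormalBasis (Fin n) ℂ E}
    (h : IsSVD T σ e) {κ : Type*} (s : Finset κ) (x y : κ → E)
    (hT : ∀ v, T v = ∑ i ∈ s, (inner ℂ (y i) v) • x i) {p : ℝ} (hp0 : 0 < p) (hp1 : p < 1) :
    ∑ k, σ k ^ p ≤ ∑ i ∈ s, (‖x i‖ * ‖y i‖) ^ p := by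
  -- The left singular vectors, set to `0` where `σ k = 0`. The contraction `W` maps each nonzero `f
  -- k` to `e k`, so `W T = |T|`, the polar decomposition.
  let f : Fin n → E := fun k => (((σ k)⁻¹ : ℝ) : ℂ) • T (e k)
  let W : E →ₗ[ℂ] E := ∑ k, ((innerSL ℂ (f k)).smulRight (e k) : E →L[ℂ] E).toLinearMap
  have hWv : ∀ v, W v = ∑ k, (inner ℂ (f k) v) • e k := fun v => by simp [W]
  have hff : ∀ i j, inner ℂ (f i) (T (e j)) = if i = j then (σ j : ℂ) else 0 := by
    intro i j
    simp only [f]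
    rw [inner_smul_left, h.inner_map, Complex.conj_ofReal]
    split_ifs with hij
    · subst hij
      rcases eq_or_ne (σ i) 0 with h0 | h0
      · simp [h0]
      · push_cast
        have : (σ i : ℂ) ≠ 0 := by exact_mod_cast h0
        field_simp
    · simp
  have hWn : ∀ v, ‖W v‖ ≤ ‖v‖ := by
    intro v
    have h1 : ‖W v‖ ^ 2 = ∑ k, ‖inner ℂ (f k) v‖ ^ 2 := by
      rw [norm_sq_eq_sum e, hWv]
      exact Finset.sum_congr rfl fun k _ => by rw [e.orthonormal.inner_right_fintype]
    set u : E := ∑ k, (inner ℂ (f k) v) • f k with hu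
    have h2 : inner ℂ u v = ((‖W v‖ ^ 2 : ℝ) : ℂ) := by
      rw [h1, hu, sum_inner]
      push_cast
      refine Finset.sum_congr rfl fun k _ => ?_
      rw [inner_smul_left, Complex.conj_mul']
    have h3 : ‖u‖ ^ 2 ≤ ‖W v‖ ^ 2 := by
      have : u = ∑ k, (inner ℂ (f k) v * (((σ k)⁻¹ : ℝ) : ℂ)) • T (e k) := by
        rw [hu]; exact Finset.sum_congr rfl fun k _ => by simp only [f, smul_smul]
      rw [this, h.norm_sq_sum_smul, h1]
      refine Finset.sum_le_sum fun k _ => ?_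
      rw [norm_mul, Complex.norm_real, Real.norm_of_nonneg (inv_nonneg.2 (h.nonneg k)), mul_pow]
      rcases eq_or_ne (σ k) 0 with h0 | h0
      · simp [h0]
      · field_simp; exact le_rfl
    have h4 : ‖W v‖ ^ 2 ≤ ‖u‖ * ‖v‖ := by
      have := norm_inner_le_norm (𝕜 := ℂ) u v
      rw [h2, Complex.norm_real, Real.norm_of_nonneg (by positivity)] at this
      exact this
    have h5 : ‖u‖ ≤ ‖W v‖ := le_of_sq_le_sq h3 (norm_nonneg _)
    by_contra hlt
    push Not at hlt
    nlinarith [norm_nonneg v, norm_nonneg (W v), norm_nonneg u]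
  choose z hz1 hz2 using fun i => exists_re_inner_mul_inner_le (W (x i)) (y i)
  -- The form of `|T| = W T = ∑ (W x_i) ⊗ y_i` is real, so each term may be replaced by its real
  -- part and dominated by `z_i ⊗ z_i`.
  have hform : ∀ v, ∑ k, σ k * ‖inner ℂ (e k) v‖ ^ 2 ≤ ∑ i ∈ s, ‖inner ℂ (z i) v‖ ^ 2 := by
    intro v
    have h1 : inner ℂ v (W (T v)) = ((∑ k, σ k * ‖inner ℂ (e k) v‖ ^ 2 : ℝ) : ℂ) := by
      rw [hWv, inner_sum]
      push_cast
      refine Finset.sum_congr rfl fun k _ => ?_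
      have : inner ℂ (f k) (T v) = inner ℂ (e k) v * (σ k : ℂ) := by
        rw [IsSVD.map_eq_sum T e v, inner_sum, Finset.sum_eq_single k]
        · rw [inner_smul_right, hff, if_pos rfl]
        · intro b _ hb
          rw [inner_smul_right, hff, if_neg (Ne.symm hb), mul_zero]
        · simp
      rw [inner_smul_right, this, ← inner_conj_symm v (e k), mul_right_comm, Complex.mul_conj',
        mul_comm]
    have h2 : inner ℂ v (W (T v)) = ∑ i ∈ s, inner ℂ v (W (x i)) * inner ℂ (y i) v := by
      rw [hT, map_sum, inner_sum]
      refine Finset.sum_congr rfl fun i _ => ?_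
      rw [map_smul, inner_smul_right, mul_comm]
    have h3 := congrArg Complex.re (h1.symm.trans h2)
    rw [Complex.ofReal_re, Complex.re_sum] at h3
    rw [h3]
    exact Finset.sum_le_sum fun i _ => hz2 i v
  refine (sum_rpow_le_of_le s z e σ h.nonneg h.antitone hform hp0 hp1).trans
    (Finset.sum_le_sum fun i _ => Real.rpow_le_rpow (by positivity) ((hz1 i).trans ?_) hp0.le)
  exact mul_le_mul_of_nonneg_right (hWn _) (norm_nonneg _)

/-- The `p`-triangle inequality for the Schatten quasi-norms, `p < 1`. -/
theorem tsum_singularValue_add_le [FiniteDimensional ℂ E] (A B : E →L[ℂ] E) {p : ℝ} (hp0 : 0 < p)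
    (hp1 : p < 1) :
    ∑' j, singularValue (A + B) j ^ p ≤
      ∑' j, singularValue A j ^ p + ∑' j, singularValue B j ^ p := by
  obtain ⟨σ, e, h⟩ := exists_isSVD rfl (A + B)
  obtain ⟨α, a, hA⟩ := exists_isSVD rfl A
  obtain ⟨β, b, hB⟩ := exists_isSVD rfl B
  rw [h.tsum_singularValue hp0, hA.tsum_singularValue hp0, hB.tsum_singularValue hp0,
    ← ENNReal.ofReal_add (Finset.sum_nonneg fun k _ => Real.rpow_nonneg (hA.nonneg k) p)
      (Finset.sum_nonneg fun k _ => Real.rpow_nonneg (hB.nonneg k) p)]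
  refine ENNReal.ofReal_le_ofReal ?_
  -- The decompositions of `A` and `B` together write `A + B` as rank one terms of norms `α k` and
  -- `β k`.
  have := h.sum_rpow_le Finset.univ (Sum.elim (fun k => A (a k)) fun k => B (b k))
    (Sum.elim a b) (fun v => ?_) hp0 hp1
  · simpa [Fintype.sum_sum_type, hA.norm_map_basis, hB.norm_map_basis] using this
  · simp [Fintype.sum_sum_type, ← IsSVD.map_eq_sum]

end Atomic

/-! ### The ideal property of the Schatten quasi-norms. -/

section Ideal

universe u

variable {D E F G : Type u}
  [NormedAddCommGroup D] [InnerProductSpace ℂ D] [NormedAddCommGroup E] [InnerProductSpace ℂ E]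
  [NormedAddCommGroup F] [InnerProductSpace ℂ F] [NormedAddCommGroup G] [InnerProductSpace ℂ G]

theorem singularValue_comp_comp_le (X : F →L[ℂ] G) (T : E →L[ℂ] F) (Y : D →L[ℂ] E) {c : ℝ}
    (hc : 0 < c) (hX : ‖X‖ ≤ c) (hY : ‖Y‖ ≤ 1) (j : ℕ) :
    singularValue (X ∘L T ∘L Y) j ≤ ENNReal.ofReal c * singularValue T j := by
  -- A nonzero factor is needed to pass inside the infimum: for `R` of too large rank the inner
  -- infimum is `∞`, and `0 * ∞ = 0`.
  have hc0 : ENNReal.ofReal c ≠ 0 := by simpa using hc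
  unfold singularValue
  rw [ENNReal.mul_iInf_of_ne hc0 ENNReal.ofReal_ne_top]
  refine le_iInf fun R => ?_
  rw [ENNReal.mul_iInf_of_ne hc0 ENNReal.ofReal_ne_top]
  refine le_iInf fun hR => ?_
  have hrank : LinearMap.rank ((X ∘L R ∘L Y : D →L[ℂ] G) : D →ₗ[ℂ] G) ≤ (j : Cardinal) := by
    have h1 := LinearMap.rank_comp_le_left (Y : D →ₗ[ℂ] E) (R : E →ₗ[ℂ] F)
    have h2 := LinearMap.rank_comp_le_right ((R : E →ₗ[ℂ] F) ∘ₗ (Y : D →ₗ[ℂ] E))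
      (X : F →ₗ[ℂ] G)
    exact h2.trans (h1.trans hR)
  refine (iInf₂_le (X ∘L R ∘L Y) hrank).trans ?_
  have heq : X ∘L T ∘L Y - X ∘L R ∘L Y = X ∘L (T - R) ∘L Y := by ext; simp
  rw [heq, ← ofReal_norm, ← ofReal_norm, ← ENNReal.ofReal_mul hc.le]
  refine ENNReal.ofReal_le_ofReal ?_
  calc ‖X ∘L (T - R) ∘L Y‖ ≤ ‖X‖ * (‖T - R‖ * ‖Y‖) :=
        (X.opNorm_comp_le _).trans (by gcongr; exact (T - R).opNorm_comp_le Y)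
    _ ≤ c * (‖T - R‖ * 1) := by gcongr
    _ = c * ‖T - R‖ := by rw [mul_one]

theorem tsum_singularValue_comp_comp_le (X : F →L[ℂ] G) (T : E →L[ℂ] F) (Y : D →L[ℂ] E) {c : ℝ}
    (hc : 0 < c) (hX : ‖X‖ ≤ c) (hY : ‖Y‖ ≤ 1) {p : ℝ} (hp : 0 < p) :
    ∑' j, singularValue (X ∘L T ∘L Y) j ^ p ≤
      ENNReal.ofReal (c ^ p) * ∑' j, singularValue T j ^ p := by
  rw [← ENNReal.tsum_mul_left]
  refine ENNReal.tsum_le_tsum fun j => ?_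
  rw [← ENNReal.ofReal_rpow_of_pos hc, ← ENNReal.mul_rpow_of_nonneg _ _ hp.le]
  exact ENNReal.rpow_le_rpow (singularValue_comp_comp_le X T Y hc hX hY j) hp.le

theorem schattenNormOp_comp_comp_le (X : F →L[ℂ] G) (T : E →L[ℂ] F) (Y : D →L[ℂ] E)
    (hX : ‖X‖ ≤ 1) (hY : ‖Y‖ ≤ 1) {p : ℝ} (hp : 0 < p) :
    schattenNormOp p (X ∘L T ∘L Y) ≤ schattenNormOp p T := by
  have := tsum_singularValue_comp_comp_le X T Y one_pos hX hY hp
  rw [Real.one_rpow, ENNReal.ofReal_one, one_mul] at this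
  exact ENNReal.rpow_le_rpow this (by positivity)

theorem schattenNormOp_rpow (T : E →L[ℂ] F) {p : ℝ} (hp : 0 < p) :
    schattenNormOp p T ^ p = ∑' j, singularValue T j ^ p := by
  rw [schattenNormOp, ← ENNReal.rpow_mul, one_div_mul_cancel hp.ne', ENNReal.rpow_one]

end Ideal

/-! ### Operators with a given matrix, coordinate embeddings and diagonal scalings. -/

section HasMatrix

variable {ι : Type*} [DecidableEq ι]

theorem HasMatrix.unique {T S : lp (fun _ : ι => ℂ) 2 →L[ℂ] lp (fun _ : ι => ℂ) 2}
    {A : Matrix ι ι ℂ} (hT : HasMatrix T A) (hS : HasMatrix S A) : T = S := by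
  refine lp.ext_continuousLinearMap (by simp) fun i => ?_
  ext j
  simp [hT j i, hS j i]

theorem HasMatrix.schattenNorm_eq {T : lp (fun _ : ι => ℂ) 2 →L[ℂ] lp (fun _ : ι => ℂ) 2}
    {A : Matrix ι ι ℂ} (hT : HasMatrix T A) (p : ℝ) : schattenNorm p A = schattenNormOp p T :=
  le_antisymm (iInf₂_le T hT) (le_iInf₂ fun S hS => by rw [hT.unique hS])

theorem HasMatrix.add {T S : lp (fun _ : ι => ℂ) 2 →L[ℂ] lp (fun _ : ι => ℂ) 2}
    {A B : Matrix ι ι ℂ} (hT : HasMatrix T A) (hS : HasMatrix S B) : HasMatrix (T + S) (A + B) :=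
  fun j k => by
    rw [add_apply, lp.coeFn_add, Pi.add_apply, hT j k, hS j k, Matrix.add_apply]

end HasMatrix

section WeightedEmbedding

variable {n : ℕ} {ι : Type*} [DecidableEq ι]

theorem orthonormal_lp_single :
    Orthonormal ℂ fun i : ι => lp.single (E := fun _ : ι => ℂ) 2 i (1 : ℂ) := by
  rw [orthonormal_iff_ite]
  intro i j
  rw [lp.inner_single_left]
  by_cases h : i = j
  · subst h; simp
  · simp [h]

theorem lp_evalCLM_apply {ι : Type*} (j : ι) (x : lp (fun _ : ι => ℂ) 2) :
    lp.evalCLM ℂ (fun _ : ι => ℂ) 2 j x = x j := rfl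

theorem sum_smul_single_coord {κ : Type*} (s : Finset κ) (f : κ → ι) (a : κ → ℂ) (j : ι) :
    (∑ i ∈ s, a i • lp.single (E := fun _ : ι => ℂ) 2 (f i) (1 : ℂ)) j =
      ∑ i ∈ s, if j = f i then a i else 0 := by
  rw [← lp_evalCLM_apply, map_sum]
  refine Finset.sum_congr rfl fun i _ => ?_
  rw [lp_evalCLM_apply, lp.coeFn_smul, Pi.smul_apply, lp.single_apply, Pi.single_apply]
  split_ifs <;> simp

/-- The operator `ℂⁿ → ℓ²(ι)` that maps `eᵢ` to `dᵢ e_{f i}`. -/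
noncomputable def weightedEmbedding (f : Fin n → ι) (d : Fin n → ℂ) :
    lp (fun _ : Fin n => ℂ) 2 →L[ℂ] lp (fun _ : ι => ℂ) 2 :=
  ∑ i, (lp.evalCLM ℂ (fun _ : Fin n => ℂ) 2 i).smulRight
    (d i • lp.single (E := fun _ : ι => ℂ) 2 (f i) (1 : ℂ))

theorem weightedEmbedding_apply (f : Fin n → ι) (d : Fin n → ℂ) (x : lp (fun _ : Fin n => ℂ) 2) :
    weightedEmbedding f d x =
      ∑ i, (x i * d i) • lp.single (E := fun _ : ι => ℂ) 2 (f i) (1 : ℂ) := by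
  simp [weightedEmbedding, smul_smul, lp_evalCLM_apply]

theorem weightedEmbedding_single (f : Fin n → ι) (d : Fin n → ℂ) (k : Fin n) :
    weightedEmbedding f d (lp.single 2 k (1 : ℂ)) =
      d k • lp.single (E := fun _ : ι => ℂ) 2 (f k) (1 : ℂ) := by
  rw [weightedEmbedding_apply, Finset.sum_eq_single k]
  · simp
  · intro b _ hb
    rw [lp.single_apply_ne _ _ _ hb, zero_mul, zero_smul]
  · simp

theorem lp_eq_sum_single (x : lp (fun _ : Fin n => ℂ) 2) :
    x = ∑ i, x i • lp.single (E := fun _ : Fin n => ℂ) 2 i (1 : ℂ) := by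
  ext j
  rw [sum_smul_single_coord]
  simp

theorem norm_sq_sum_smul_single {f : Fin n → ι} (hf : Function.Injective f) (a : Fin n → ℂ) :
    ‖∑ i, a i • lp.single (E := fun _ : ι => ℂ) 2 (f i) (1 : ℂ)‖ ^ 2 = ∑ i, ‖a i‖ ^ 2 := by
  have h := (orthonormal_lp_single.comp f hf).inner_sum a a Finset.univ
  rw [Function.comp_def, inner_self_eq_norm_sq_to_K] at h
  refine Complex.ofReal_injective ?_
  push_cast
  exact h.trans (Finset.sum_congr rfl fun i _ => Complex.conj_mul' _)

theorem lp_norm_sq_eq_sum (x : lp (fun _ : Fin n => ℂ) 2) : ‖x‖ ^ 2 = ∑ i, ‖x i‖ ^ 2 := by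
  conv_lhs => rw [lp_eq_sum_single x]
  exact norm_sq_sum_smul_single Function.injective_id _

theorem norm_weightedEmbedding_le {f : Fin n → ι} (hf : Function.Injective f) {d : Fin n → ℂ}
    {c : ℝ} (hc : 0 ≤ c) (hd : ∀ i, ‖d i‖ ≤ c) : ‖weightedEmbedding f d‖ ≤ c := by
  refine ContinuousLinearMap.opNorm_le_bound _ hc fun x => le_of_sq_le_sq ?_ (by positivity)
  rw [weightedEmbedding_apply, norm_sq_sum_smul_single hf, mul_pow, lp_norm_sq_eq_sum,
    Finset.mul_sum]
  refine Finset.sum_le_sum fun i _ => ?_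
  rw [norm_mul, mul_pow, mul_comm]
  have := hd i
  gcongr

theorem weightedEmbedding_coord {f : Fin n → ι} (hf : Function.Injective f) (d : Fin n → ℂ)
    (x : lp (fun _ : Fin n => ℂ) 2) (i : Fin n) : weightedEmbedding f d x (f i) = x i * d i := by
  rw [weightedEmbedding_apply, sum_smul_single_coord]
  simp [hf.eq_iff]

theorem weightedEmbedding_coord_of_notMem {f : Fin n → ι} (d : Fin n → ℂ)
    (x : lp (fun _ : Fin n => ℂ) 2) {j : ι} (hj : ∀ i, f i ≠ j) :
    weightedEmbedding f d x j = 0 := by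
  rw [weightedEmbedding_apply, sum_smul_single_coord]
  simp [fun i => (hj i).symm]

theorem adjoint_weightedEmbedding_coord (f : Fin n → ι) (x : lp (fun _ : ι => ℂ) 2) (i : Fin n) :
    (weightedEmbedding f 1).adjoint x i = x (f i) := by
  have h1 := lp.inner_single_left (𝕜 := ℂ) (G := fun _ : Fin n => ℂ) i (1 : ℂ)
    ((weightedEmbedding f 1).adjoint x)
  rw [ContinuousLinearMap.adjoint_inner_right, weightedEmbedding_single, Pi.one_apply, one_smul,
    lp.inner_single_left] at h1
  simpa using h1.symm

theorem adjoint_weightedEmbedding_single {f : Fin n → ι} (hf : Function.Injective f) (k : Fin n) :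
    (weightedEmbedding f 1).adjoint (lp.single 2 (f k) (1 : ℂ)) = lp.single 2 k (1 : ℂ) := by
  ext i
  rw [adjoint_weightedEmbedding_coord]
  simp [Pi.single_apply, hf.eq_iff]

theorem adjoint_weightedEmbedding_single_of_notMem {f : Fin n → ι} {m : ι} (hm : ∀ i, f i ≠ m) :
    (weightedEmbedding f 1).adjoint (lp.single 2 m (1 : ℂ)) = 0 := by
  ext i
  rw [adjoint_weightedEmbedding_coord]
  simp [hm i]

theorem norm_adjoint_weightedEmbedding_le {f : Fin n → ι} (hf : Function.Injective f) :
    ‖(weightedEmbedding f 1).adjoint‖ ≤ 1 := by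
  rw [LinearIsometryEquiv.norm_map]
  exact norm_weightedEmbedding_le hf zero_le_one fun i => by simp

theorem exists_hasMatrix (A : Matrix (Fin n) (Fin n) ℂ) :
    ∃ T : lp (fun _ : Fin n => ℂ) 2 →L[ℂ] lp (fun _ : Fin n => ℂ) 2, HasMatrix T A := by
  refine ⟨∑ k, (lp.evalCLM ℂ (fun _ : Fin n => ℂ) 2 k).smulRight
    (∑ j, A j k • lp.single (E := fun _ : Fin n => ℂ) 2 j (1 : ℂ)), fun j k => ?_⟩
  rw [sum_apply, Finset.sum_eq_single k]
  · rw [ContinuousLinearMap.smulRight_apply, lp_evalCLM_apply, lp.single_apply_self, one_smul,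
      sum_smul_single_coord]
    simp
  · intro b _ hb
    rw [ContinuousLinearMap.smulRight_apply, lp_evalCLM_apply, lp.single_apply_ne _ _ _ hb,
      zero_smul]
  · simp

instance finiteDimensional_lp_fin : FiniteDimensional ℂ (lp (fun _ : Fin n => ℂ) 2) :=
  Module.Finite.of_surjective
    (∑ i, (LinearMap.proj i : (Fin n → ℂ) →ₗ[ℂ] ℂ).smulRight
      (lp.single (E := fun _ : Fin n => ℂ) 2 i (1 : ℂ)))
    fun x => ⟨x, by
      conv_rhs => rw [lp_eq_sum_single x]
      simp⟩

theorem schattenNorm_rpow_add_le (A B : Matrix (Fin n) (Fin n) ℂ) {p : ℝ} (hp0 : 0 < p)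
    (hp1 : p < 1) :
    schattenNorm p (A + B) ^ p ≤ schattenNorm p A ^ p + schattenNorm p B ^ p := by
  obtain ⟨T, hT⟩ := exists_hasMatrix A
  obtain ⟨S, hS⟩ := exists_hasMatrix B
  rw [(hT.add hS).schattenNorm_eq, hT.schattenNorm_eq, hS.schattenNorm_eq,
    schattenNormOp_rpow _ hp0, schattenNormOp_rpow _ hp0, schattenNormOp_rpow _ hp0]
  exact tsum_singularValue_add_le T S hp0 hp1

theorem schattenNorm_rpow_diagonal_mul_mul_le (A : Matrix (Fin n) (Fin n) ℂ) (d e : Fin n → ℂ)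
    {c : ℝ} (hc : 0 < c) (hd : ∀ i, ‖d i‖ ≤ c) (he : ∀ i, ‖e i‖ ≤ 1) {p : ℝ} (hp : 0 < p) :
    schattenNorm p (Matrix.of fun i j => d i * A i j * e j) ^ p ≤
      ENNReal.ofReal (c ^ p) * schattenNorm p A ^ p := by
  obtain ⟨T, hT⟩ := exists_hasMatrix A
  have h : HasMatrix (weightedEmbedding id d ∘L T ∘L weightedEmbedding id e)
      (Matrix.of fun i j => d i * A i j * e j) := by
    intro i j
    rw [ContinuousLinearMap.comp_apply, ContinuousLinearMap.comp_apply, weightedEmbedding_single,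
      map_smul, map_smul, lp.coeFn_smul, Pi.smul_apply]
    have := weightedEmbedding_coord Function.injective_id d (T (lp.single 2 j (1 : ℂ))) i
    rw [id] at this
    rw [id, this, hT i j, Matrix.of_apply, smul_eq_mul]
    ring
  rw [h.schattenNorm_eq, hT.schattenNorm_eq, schattenNormOp_rpow _ hp, schattenNormOp_rpow _ hp]
  exact tsum_singularValue_comp_comp_le _ _ _ hc
    (norm_weightedEmbedding_le Function.injective_id hc.le hd)
    (norm_weightedEmbedding_le Function.injective_id zero_le_one he) hp

end WeightedEmbedding

/-! ### Submatrices, padding by zeros, and the passage from `χₙ` to `Δₙ`. -/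

section Compression

variable {n : ℕ} {ι : Type} [DecidableEq ι]

theorem schattenNorm_submatrix_le {f g : Fin n → ι} (hf : Function.Injective f)
    (hg : Function.Injective g) (A : Matrix ι ι ℂ) {p : ℝ} (hp : 0 < p) :
    schattenNorm p (A.submatrix f g) ≤ schattenNorm p A := by
  refine le_iInf₂ fun T hT => ?_
  have h : HasMatrix ((weightedEmbedding f 1).adjoint ∘L T ∘L weightedEmbedding g 1)
      (A.submatrix f g) := fun i j => by
    rw [ContinuousLinearMap.comp_apply, ContinuousLinearMap.comp_apply,
      adjoint_weightedEmbedding_coord, weightedEmbedding_single, Pi.one_apply, one_smul, hT,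
      Matrix.submatrix_apply]
  rw [h.schattenNorm_eq]
  exact schattenNormOp_comp_comp_le _ _ _ (norm_adjoint_weightedEmbedding_le hf)
    (norm_weightedEmbedding_le hg zero_le_one fun i => by simp) hp

/-- A matrix supported on the rows `f` and columns `g` is recovered from its submatrix by composing
with the coordinate embedding of `f` and the adjoint of that of `g`, both contractions. -/
theorem schattenNorm_le_submatrix {f g : Fin n → ι} (hf : Function.Injective f)
    (hg : Function.Injective g) (A : Matrix ι ι ℂ)
    (hAf : ∀ i m, (∀ k, f k ≠ i) → A i m = 0) (hAg : ∀ i m, (∀ k, g k ≠ m) → A i m = 0)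
    {p : ℝ} (hp : 0 < p) :
    schattenNorm p A ≤ schattenNorm p (A.submatrix f g) := by
  refine le_iInf₂ fun T hT => ?_
  have h : HasMatrix (weightedEmbedding f 1 ∘L T ∘L (weightedEmbedding g 1).adjoint) A := by
    intro i m
    rw [ContinuousLinearMap.comp_apply, ContinuousLinearMap.comp_apply]
    by_cases hm : ∃ k, g k = m
    · obtain ⟨k, rfl⟩ := hm
      rw [adjoint_weightedEmbedding_single hg]
      by_cases hi : ∃ l, f l = i
      · obtain ⟨l, rfl⟩ := hi
        rw [weightedEmbedding_coord hf, hT l k, Pi.one_apply, mul_one, Matrix.submatrix_apply]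
      · push Not at hi
        rw [weightedEmbedding_coord_of_notMem _ _ hi, hAf _ _ hi]
    · push Not at hm
      rw [adjoint_weightedEmbedding_single_of_notMem hm, map_zero, map_zero, hAg _ _ hm]
      rfl
  rw [h.schattenNorm_eq]
  exact schattenNormOp_comp_comp_le _ _ _
    (norm_weightedEmbedding_le hf zero_le_one fun i => by simp)
    (norm_adjoint_weightedEmbedding_le hg) hp

end Compression

theorem schurMultiplierNorm_chiMatrix_eq_deltaMatrix (n : ℕ) {p : ℝ} (hp : 0 < p) :
    schurMultiplierNorm p (chiMatrix n) = schurMultiplierNorm p (deltaMatrix n) := by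
  have hf : Function.Injective (fun i : Fin n => (i : ℕ)) := Fin.val_injective
  have hg : Function.Injective (fun i : Fin n => (i.rev : ℕ)) :=
    Fin.val_injective.comp Fin.rev_injective
  have hf' : ∀ i, (∀ k : Fin n, (k : ℕ) ≠ i) → n ≤ i := fun i hi => by
    by_contra hlt
    exact hi ⟨i, not_le.1 hlt⟩ rfl
  have hg' : ∀ i, (∀ k : Fin n, (k.rev : ℕ) ≠ i) → n ≤ i := fun i hi => by
    by_contra hlt
    exact hi (Fin.rev ⟨i, not_le.1 hlt⟩) (by rw [Fin.rev_rev])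
  have hsub : ∀ B : Matrix ℕ ℕ ℂ,
      (deltaMatrix n ⊙ B).submatrix (fun i : Fin n => (i : ℕ)) (fun i : Fin n => (i.rev : ℕ)) =
        chiMatrix n ⊙ B.submatrix (fun i : Fin n => (i : ℕ)) (fun i : Fin n => (i.rev : ℕ)) := by
    intro B
    ext i k
    have : ((i : ℕ) + (n - ((k : ℕ) + 1)) < n) ↔ i ≤ k := by
      rw [Fin.le_def]; omega
    simp [deltaMatrix, chiMatrix, this]
  refine le_antisymm (iSup₂_le fun B hB => ?_) (iSup₂_le fun B hB => ?_)
  -- `B` with its columns reversed, padded by zeros to an infinite matrix.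
  · let B' : Matrix ℕ ℕ ℂ := Matrix.of fun i m =>
      if h : i < n ∧ m < n then B ⟨i, h.1⟩ (Fin.rev ⟨m, h.2⟩) else 0
    have hB' : B'.submatrix (fun i : Fin n => (i : ℕ)) (fun i : Fin n => (i.rev : ℕ)) = B := by
      ext i k
      have h : (i : ℕ) < n ∧ (k.rev : ℕ) < n := ⟨i.2, k.rev.2⟩
      simp only [B', Matrix.submatrix_apply, Matrix.of_apply, dif_pos h, Fin.eta, Fin.rev_rev]
    have h1 : schattenNorm p B' ≤ 1 := by
      refine le_trans ?_ hB
      conv_rhs => rw [← hB']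
      refine schattenNorm_le_submatrix hf hg B' (fun i m hi => ?_) (fun i m hm => ?_) hp
      · have := hf' i hi
        exact dif_neg (by omega)
      · have := hg' m hm
        exact dif_neg (by omega)
    refine le_trans ?_ (le_iSup₂ (f := fun B (_ : schattenNorm p B ≤ 1) =>
      schattenNorm p (deltaMatrix n ⊙ B)) B' h1)
    rw [← hB', ← hsub]
    exact schattenNorm_submatrix_le hf hg _ hp
  · refine le_trans ?_ (le_iSup₂ (f := fun B (_ : schattenNorm p B ≤ 1) =>
      schattenNorm p (chiMatrix n ⊙ B)) (B.submatrix (fun i : Fin n => (i : ℕ))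
        (fun i : Fin n => (i.rev : ℕ))) ((schattenNorm_submatrix_le hf hg B hp).trans hB))
    rw [← hsub]
    refine schattenNorm_le_submatrix hf hg _ (fun i m hi => ?_) (fun i m hm => ?_) hp
    · have := hf' i hi
      simp [deltaMatrix, show ¬ (i + m < n) by omega]
    · have := hg' m hm
      simp [deltaMatrix, show ¬ (i + m < n) by omega]

theorem transformerNorm_triangularProjection (n : ℕ) (p : ℝ) :
    transformerNorm p (triangularProjection n) = schurMultiplierNorm p (chiMatrix n) := by
  have : ∀ B, triangularProjection n B = chiMatrix n ⊙ B := fun B => by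
    ext i j
    simp [triangularProjection, chiMatrix]
  simp only [transformerNorm, schurMultiplierNorm, this]

/-! ### Upper bound by dyadic decomposition. -/

section Upper

variable {n : ℕ}

/-- The part of a matrix in the diagonal blocks of size `2 ^ t`. -/
def dyadicBlockPart (t : ℕ) (A : Matrix (Fin n) (Fin n) ℂ) : Matrix (Fin n) (Fin n) ℂ :=
  Matrix.of fun i j => if (i : ℕ) / 2 ^ t = (j : ℕ) / 2 ^ t then A i j else 0

theorem schattenNorm_dyadicBlockPart_le (t : ℕ) (A : Matrix (Fin n) (Fin n) ℂ) {p : ℝ}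
    (hp0 : 0 < p) (hp1 : p < 1) :
    schattenNorm p (dyadicBlockPart t A) ^ p ≤
      ENNReal.ofReal (2 ^ (1 - p)) * schattenNorm p (dyadicBlockPart (t + 1) A) ^ p := by
  -- Signs alternating between consecutive blocks of size `2 ^ t`. Averaging `X` with its conjugate
  -- by `s` cancels the entries joining the two halves of a block of size `2 ^ (t + 1)`.
  let s : Fin n → ℂ := fun i => if (i : ℕ) / 2 ^ t % 2 = 0 then 1 else -1
  let X := dyadicBlockPart (t + 1) A
  have hs : ∀ i, ‖s i‖ ≤ 1 := fun i => by simp only [s]; split_ifs <;> simp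
  have heq : dyadicBlockPart t A = (Matrix.of fun i j => (1 / 2 : ℂ) * X i j * 1) +
      Matrix.of fun i j => (1 / 2 * s i) * X i j * s j := by
    ext i j
    simp only [dyadicBlockPart, X, s, Matrix.add_apply, Matrix.of_apply, pow_succ,
      ← Nat.div_div_eq_div_mul]
    generalize (i : ℕ) / 2 ^ t = a
    generalize (j : ℕ) / 2 ^ t = b
    split_ifs <;> first | omega | ring
  have h1 := schattenNorm_rpow_diagonal_mul_mul_le X (fun _ => 1 / 2) (fun _ => 1)
    (c := 1 / 2) (by norm_num) (fun i => by norm_num) (fun i => by simp) hp0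
  have h2 := schattenNorm_rpow_diagonal_mul_mul_le X (fun i => 1 / 2 * s i) s
    (c := 1 / 2) (by norm_num) (fun i => by
      rw [norm_mul]
      calc _ ≤ ‖(1 / 2 : ℂ)‖ * 1 := by gcongr; exact hs i
        _ ≤ _ := by norm_num) hs hp0
  have hc : ENNReal.ofReal (2 ^ (1 - p)) =
      ENNReal.ofReal ((1 / 2) ^ p) + ENNReal.ofReal ((1 / 2) ^ p) := by
    rw [← ENNReal.ofReal_add (by positivity) (by positivity)]
    congr 1
    rw [Real.rpow_sub two_pos, Real.rpow_one, one_div, Real.inv_rpow two_pos.le]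
    ring
  rw [heq, hc, add_mul]
  exact (schattenNorm_rpow_add_le _ _ hp0 hp1).trans (add_le_add h1 h2)

/-- The last summand selects rows in the first half and columns in the second half of each larger
block. This corner lies wholly above the diagonal, so `chiMatrix n` leaves it intact. -/
theorem chiMatrix_hadamard_dyadicBlockPart_succ (t : ℕ) (A : Matrix (Fin n) (Fin n) ℂ) :
    chiMatrix n ⊙ dyadicBlockPart (t + 1) A = chiMatrix n ⊙ dyadicBlockPart t A +
      Matrix.of fun i j : Fin n => (if (i : ℕ) / 2 ^ t % 2 = 0 then 1 else 0) *
        dyadicBlockPart (t + 1) A i j * (if (j : ℕ) / 2 ^ t % 2 = 1 then 1 else 0) := by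
  ext i j
  have h1 : (i : ℕ) ≤ j → (i : ℕ) / 2 ^ t ≤ (j : ℕ) / 2 ^ t := fun h => Nat.div_le_div_right h
  have h2 : (j : ℕ) ≤ i → (j : ℕ) / 2 ^ t ≤ (i : ℕ) / 2 ^ t := fun h => Nat.div_le_div_right h
  simp only [dyadicBlockPart, chiMatrix, Matrix.hadamard_apply, Matrix.add_apply, Matrix.of_apply,
    pow_succ, ← Nat.div_div_eq_div_mul, Fin.le_def]
  generalize (i : ℕ) / 2 ^ t = a at *
  generalize (j : ℕ) / 2 ^ t = b at *
  split_ifs <;> first | omega | simp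

theorem schattenNorm_chiMatrix_hadamard_dyadicBlockPart_succ_le (t : ℕ)
    (A : Matrix (Fin n) (Fin n) ℂ) {p : ℝ} (hp0 : 0 < p) (hp1 : p < 1) :
    schattenNorm p (chiMatrix n ⊙ dyadicBlockPart (t + 1) A) ^ p ≤
      schattenNorm p (chiMatrix n ⊙ dyadicBlockPart t A) ^ p +
        schattenNorm p (dyadicBlockPart (t + 1) A) ^ p := by
  rw [chiMatrix_hadamard_dyadicBlockPart_succ]
  refine (schattenNorm_rpow_add_le _ _ hp0 hp1).trans (add_le_add le_rfl ?_)
  have := schattenNorm_rpow_diagonal_mul_mul_le (dyadicBlockPart (t + 1) A)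
    (fun i => if (i : ℕ) / 2 ^ t % 2 = 0 then 1 else 0)
    (fun j => if (j : ℕ) / 2 ^ t % 2 = 1 then 1 else 0) one_pos
    (fun i => by split_ifs <;> simp) (fun i => by split_ifs <;> simp) hp0
  simpa using this

theorem schattenNorm_chiMatrix_hadamard_rpow_le {m : ℕ} (hm : n ≤ 2 ^ m)
    (A : Matrix (Fin n) (Fin n) ℂ) {p : ℝ} (hp0 : 0 < p) (hp1 : p < 1)
    (hA : schattenNorm p A ≤ 1) :
    schattenNorm p (chiMatrix n ⊙ A) ^ p ≤
      ENNReal.ofReal ((2 ^ (1 - p)) ^ (m + 1) / (2 ^ (1 - p) - 1)) := by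
  set q : ℝ := 2 ^ (1 - p) with hq
  have hq1 : 1 < q := Real.one_lt_rpow one_lt_two (by linarith)
  have hq0 : 0 < q := by linarith
  have hAm : dyadicBlockPart m A = A := by
    ext i j
    have hi : (i : ℕ) / 2 ^ m = 0 := Nat.div_eq_of_lt (i.2.trans_le hm)
    have hj : (j : ℕ) / 2 ^ m = 0 := Nat.div_eq_of_lt (j.2.trans_le hm)
    simp [dyadicBlockPart, hi, hj]
  have hb : ∀ s ≤ m, schattenNorm p (dyadicBlockPart (m - s) A) ^ p ≤ ENNReal.ofReal (q ^ s) := by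
    intro s
    induction s with
    | zero =>
      intro _
      rw [Nat.sub_zero, hAm, pow_zero, ENNReal.ofReal_one]
      exact ENNReal.rpow_le_one hA hp0.le
    | succ s ih =>
      intro hs
      refine (schattenNorm_dyadicBlockPart_le _ A hp0 hp1).trans ?_
      rw [show m - (s + 1) + 1 = m - s by omega, pow_succ', ENNReal.ofReal_mul hq0.le]
      exact mul_le_mul_right (ih (by omega)) _
  -- The right side is the closed form of the geometric sum `q^m + q^(m-1) + ⋯ + q^(m-t)`.
  have ha : ∀ t ≤ m, schattenNorm p (chiMatrix n ⊙ dyadicBlockPart t A) ^ p ≤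
      ENNReal.ofReal (q ^ (m + 1) / (q - 1) * (1 - (q ^ (t + 1))⁻¹)) := by
    intro t
    induction t with
    | zero =>
      intro _
      -- Blocks of size one form the diagonal, which `chiMatrix n` preserves.
      have h0 : chiMatrix n ⊙ dyadicBlockPart 0 A = dyadicBlockPart 0 A := by
        ext i j
        simp only [chiMatrix, dyadicBlockPart, Matrix.hadamard_apply, Matrix.of_apply, pow_zero,
          Nat.div_one, Fin.le_def]
        split_ifs <;> first | omega | simp
      have h1 := hb m le_rfl
      rw [Nat.sub_self] at h1
      rw [h0]
      refine h1.trans_eq (congrArg _ ?_)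
      have : q - 1 ≠ 0 := by linarith
      field_simp
      ring
    | succ t ih =>
      intro ht
      refine (schattenNorm_chiMatrix_hadamard_dyadicBlockPart_succ_le t A hp0 hp1).trans ?_
      have h1 := hb (m - (t + 1)) (by omega)
      rw [show m - (m - (t + 1)) = t + 1 by omega] at h1
      refine (add_le_add (ih (by omega)) h1).trans_eq ?_
      have h2 : (q ^ (t + 1))⁻¹ ≤ 1 := inv_le_one_of_one_le₀ (one_le_pow₀ hq1.le)
      rw [← ENNReal.ofReal_add (mul_nonneg (div_nonneg (by positivity) (by linarith))
        (by linarith)) (by positivity)]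
      congr 1
      obtain ⟨d, rfl⟩ := Nat.exists_eq_add_of_le ht
      rw [Nat.add_sub_cancel_left]
      have : q - 1 ≠ 0 := by linarith
      field_simp
      ring
  have := ha m le_rfl
  rw [hAm] at this
  refine this.trans (ENNReal.ofReal_le_ofReal (mul_le_of_le_one_right
    (div_nonneg (by positivity) (by linarith)) ?_))
  have : 0 ≤ (q ^ (m + 1))⁻¹ := by positivity
  linarith

theorem schurMultiplierNorm_chiMatrix_le (hn : 1 ≤ n) {p : ℝ} (hp0 : 0 < p) (hp1 : p < 1) :
    schurMultiplierNorm p (chiMatrix n) ≤ ENNReal.ofReal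
      (((2 ^ (1 - p)) ^ 2 / (2 ^ (1 - p) - 1)) ^ (1 / p) * (n : ℝ) ^ (1 / p - 1)) := by
  refine iSup₂_le fun A hA => ?_
  -- With `m = Nat.log 2 n + 1` the bound `q ^ (m + 1)` is `q ^ 2 * q ^ Nat.log 2 n`, which is where
  -- the `q ^ 2` in the constant comes from.
  have hm : n ≤ 2 ^ (Nat.log 2 n + 1) := (Nat.lt_pow_succ_log_self one_lt_two n).le
  have hm' : 2 ^ Nat.log 2 n ≤ n := Nat.pow_log_le_self 2 (by omega)
  have h := schattenNorm_chiMatrix_hadamard_rpow_le hm A hp0 hp1 hA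
  set q : ℝ := 2 ^ (1 - p) with hq
  have hq1 : 1 < q := Real.one_lt_rpow one_lt_two (by linarith)
  have hn0 : (0 : ℝ) < n := by exact_mod_cast hn
  have hpow : q ^ Nat.log 2 n ≤ (n : ℝ) ^ (1 - p) := by
    rw [hq, ← Real.rpow_natCast, ← Real.rpow_mul two_pos.le, mul_comm, Real.rpow_mul two_pos.le,
      Real.rpow_natCast]
    refine Real.rpow_le_rpow (by positivity) ?_ (by linarith)
    exact_mod_cast hm'
  have hK : 0 ≤ q ^ 2 / (q - 1) := div_nonneg (by positivity) (by linarith)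
  have h2 : schattenNorm p (chiMatrix n ⊙ A) ^ p ≤
      ENNReal.ofReal (q ^ 2 / (q - 1) * (n : ℝ) ^ (1 - p)) := by
    refine h.trans (ENNReal.ofReal_le_ofReal ?_)
    rw [add_assoc, pow_add, mul_div_assoc, mul_comm]
    exact mul_le_mul_of_nonneg_left hpow hK
  have h3 := ENNReal.rpow_le_rpow h2 (show 0 ≤ 1 / p by positivity)
  rw [← ENNReal.rpow_mul, mul_one_div_cancel hp0.ne', ENNReal.rpow_one,
    ENNReal.ofReal_rpow_of_nonneg (mul_nonneg hK (by positivity)) (by positivity),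
    Real.mul_rpow hK (by positivity), ← Real.rpow_mul hn0.le] at h3
  refine h3.trans_eq ?_
  rw [show (1 - p) * (1 / p) = 1 / p - 1 by field_simp]

end Upper

/-! ### Lower bound from a rank one projection. -/

section Lower

variable {n : ℕ}

/-- The matrix is the projection onto the unit vector `u` with equal coordinates, so only its first
singular value can be nonzero. -/
theorem schattenNorm_const_inv_le_one (hn : 1 ≤ n) {p : ℝ} (hp : 0 < p) :
    schattenNorm p (Matrix.of fun _ _ : Fin n => ((n : ℂ)⁻¹)) ≤ 1 := by
  let u : lp (fun _ : Fin n => ℂ) 2 :=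
    ∑ i, (((√n)⁻¹ : ℝ) : ℂ) • lp.single (E := fun _ : Fin n => ℂ) 2 i (1 : ℂ)
  have hui : ∀ i, u i = (((√n)⁻¹ : ℝ) : ℂ) := fun i => by
    simp only [u]
    rw [sum_smul_single_coord Finset.univ (fun i => i)]
    simp
  have hn0 : (0 : ℝ) < n := by exact_mod_cast hn
  have hsq : (√(n : ℝ))⁻¹ ^ 2 = (n : ℝ)⁻¹ := by rw [inv_pow, Real.sq_sqrt hn0.le]
  have hu : ‖u‖ = 1 := by
    have : ‖u‖ ^ 2 = 1 := by
      rw [lp_norm_sq_eq_sum]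
      simp only [hui, Complex.norm_real, Real.norm_eq_abs, sq_abs, hsq]
      simp [hn0.ne']
    exact (pow_eq_one_iff_of_nonneg (norm_nonneg _) two_ne_zero).1 this
  let T : lp (fun _ : Fin n => ℂ) 2 →L[ℂ] lp (fun _ : Fin n => ℂ) 2 :=
    (innerSL ℂ u).smulRight u
  have hT : HasMatrix T (Matrix.of fun _ _ : Fin n => ((n : ℂ)⁻¹)) := by
    intro i k
    rw [ContinuousLinearMap.smulRight_apply, innerSL_apply_apply, lp.inner_single_right,
      lp.coeFn_smul, Pi.smul_apply, hui, hui]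
    simp only [RCLike.inner_apply, Complex.conj_ofReal, one_mul, smul_eq_mul, Matrix.of_apply]
    rw [← Complex.ofReal_mul, ← sq, hsq, Complex.ofReal_inv, Complex.ofReal_natCast]
  have h0 : singularValue T 0 ≤ 1 := by
    refine (iInf₂_le 0 (by simp)).trans ?_
    rw [sub_zero, ← ofReal_norm, ContinuousLinearMap.norm_smulRight_apply, innerSL_apply_norm, hu]
    simp
  have h1 : ∀ j, j ≠ 0 → singularValue T j ^ p = 0 := by
    intro j hj
    have hrank : LinearMap.rank (T : lp (fun _ : Fin n => ℂ) 2 →ₗ[ℂ] lp (fun _ : Fin n => ℂ) 2) ≤ (j : Cardinal) := by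
      have hle : LinearMap.range (T : lp (fun _ : Fin n => ℂ) 2 →ₗ[ℂ] lp (fun _ : Fin n => ℂ) 2) ≤
          Submodule.span ℂ (({u} : Finset (lp (fun _ : Fin n => ℂ) 2)) : Set _) := by
        rintro _ ⟨v, rfl⟩
        exact Submodule.smul_mem _ _ (Submodule.subset_span (by simp))
      refine (Submodule.rank_mono hle).trans ((rank_span_finset_le _).trans ?_)
      rw [Finset.card_singleton]
      exact_mod_cast Nat.one_le_iff_ne_zero.2 hj
    have : singularValue T j ≤ 0 := (iInf₂_le T hrank).trans (by simp)
    rw [nonpos_iff_eq_zero.1 this, ENNReal.zero_rpow_of_pos hp]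
  rw [hT.schattenNorm_eq, schattenNormOp, tsum_eq_single 0 h1]
  exact ENNReal.rpow_le_one (ENNReal.rpow_le_one h0 hp.le) (by positivity)

theorem HasMatrix.apply_eq_sum {T : lp (fun _ : Fin n => ℂ) 2 →L[ℂ] lp (fun _ : Fin n => ℂ) 2}
    {A : Matrix (Fin n) (Fin n) ℂ} (hT : HasMatrix T A) (x : lp (fun _ : Fin n => ℂ) 2)
    (j : Fin n) : T x j = ∑ k, A j k * x k := by
  conv_lhs => rw [lp_eq_sum_single x]
  rw [map_sum, ← lp_evalCLM_apply, map_sum]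
  refine Finset.sum_congr rfl fun k _ => ?_
  rw [map_smul, map_smul, lp_evalCLM_apply, hT j k, smul_eq_mul, mul_comm]

/-- Applying `χₙ` forms the tail sums `w` of `v`, and `v` is recovered as their differences. The
factor `2` bounds the identity minus a shift. -/
theorem norm_le_mul_norm_of_hasMatrix_chiMatrix {c : ℝ} (hc : 0 < c)
    {S : lp (fun _ : Fin n => ℂ) 2 →L[ℂ] lp (fun _ : Fin n => ℂ) 2}
    (hS : HasMatrix S (Matrix.of fun j k => (if j ≤ k then (c : ℂ)⁻¹ else 0)))
    (v : lp (fun _ : Fin n => ℂ) 2) : ‖v‖ ≤ 2 * c * ‖S v‖ := by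
  let w : ℕ → ℂ := fun m => ∑ k : Fin n, if m ≤ (k : ℕ) then v k else 0
  have hc' : (c : ℂ) ≠ 0 := by exact_mod_cast hc.ne'
  have hw : ∀ j : Fin n, w j = c * S v j := by
    intro j
    rw [hS.apply_eq_sum, Finset.mul_sum]
    refine Finset.sum_congr rfl fun k _ => ?_
    simp only [Matrix.of_apply, Fin.le_def]
    split_ifs
    · field_simp
    · simp
  have hv : ∀ j : Fin n, v j = w j - w (j + 1) := by
    intro j
    simp only [w]
    rw [← Finset.sum_sub_distrib, Finset.sum_eq_single j]
    · simp
    · intro k _ hk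
      have : (k : ℕ) ≠ j := fun h => hk (Fin.ext h)
      split_ifs <;> first | omega | simp
    · simp
  -- The empty tail vanishes, so shifting the tail sums by one does not increase their `ℓ²` norm.
  have hwn : w n = 0 := Finset.sum_eq_zero fun k _ => if_neg (by omega)
  have h1 : ∑ j : Fin n, ‖w j‖ ^ 2 = (c * ‖S v‖) ^ 2 := by
    rw [mul_pow, lp_norm_sq_eq_sum, Finset.mul_sum]
    refine Finset.sum_congr rfl fun j _ => ?_
    rw [hw, norm_mul, Complex.norm_real, Real.norm_of_nonneg hc.le, mul_pow]
  have h2 : ∑ j : Fin n, ‖w (j + 1)‖ ^ 2 ≤ ∑ j : Fin n, ‖w j‖ ^ 2 := by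
    rw [Fin.sum_univ_eq_sum_range (fun j => ‖w (j + 1)‖ ^ 2),
      Fin.sum_univ_eq_sum_range (fun j => ‖w j‖ ^ 2)]
    have h3 := Finset.sum_range_succ (fun j => ‖w j‖ ^ 2) n
    have h4 := Finset.sum_range_succ' (fun j => ‖w j‖ ^ 2) n
    rw [hwn, norm_zero] at h3
    have : 0 ≤ ‖w 0‖ ^ 2 := by positivity
    linarith
  have h3 : ‖v‖ ^ 2 ≤ 2 * ∑ j : Fin n, ‖w j‖ ^ 2 + 2 * ∑ j : Fin n, ‖w (j + 1)‖ ^ 2 := by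
    rw [lp_norm_sq_eq_sum, Finset.mul_sum, Finset.mul_sum, ← Finset.sum_add_distrib]
    refine Finset.sum_le_sum fun j _ => ?_
    rw [hv j]
    have := norm_sub_le (w j) (w (j + 1))
    nlinarith [norm_nonneg (w j - w (j + 1)), sq_nonneg (‖w j‖ - ‖w (j + 1)‖),
      norm_nonneg (w j), norm_nonneg (w (j + 1))]
  refine le_of_sq_le_sq ?_ (by positivity)
  rw [mul_assoc, mul_pow]
  linarith

theorem le_schurMultiplierNorm_chiMatrix (hn : 1 ≤ n) {p : ℝ} (hp : 0 < p) :
    ENNReal.ofReal (1 / 2 * (n : ℝ) ^ (1 / p - 1)) ≤ schurMultiplierNorm p (chiMatrix n) := by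
  refine le_trans ?_ (le_iSup₂ (f := fun B (_ : schattenNorm p B ≤ 1) =>
    schattenNorm p (chiMatrix n ⊙ B)) _ (schattenNorm_const_inv_le_one hn hp))
  have hn0 : (0 : ℝ) < n := by exact_mod_cast hn
  have heq : chiMatrix n ⊙ (Matrix.of fun _ _ : Fin n => ((n : ℂ)⁻¹)) =
      Matrix.of fun j k => (if j ≤ k then (((n : ℝ) : ℂ))⁻¹ else 0) := by
    ext j k
    simp [chiMatrix]
  rw [heq]
  obtain ⟨S, hS⟩ := exists_hasMatrix (Matrix.of fun j k : Fin n =>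
    (if j ≤ k then (((n : ℝ) : ℂ))⁻¹ else 0))
  rw [hS.schattenNorm_eq]
  let e : OrthonormalBasis (Fin n) ℂ (lp (fun _ : Fin n => ℂ) 2) :=
    OrthonormalBasis.mk orthonormal_lp_single fun x _ => by
      rw [lp_eq_sum_single x]
      exact Submodule.sum_mem _ fun i _ => Submodule.smul_mem _ _ (Submodule.subset_span ⟨i, rfl⟩)
  -- An `R` of rank at most `j < n` has a kernel vector `v`, on which `S - R` agrees with `S`; the
  -- bound `‖v‖ ≤ 2n‖S v‖` then forces `‖S - R‖ ≥ 1/(2n)`.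
  have hs : ∀ j ∈ Finset.range n, ENNReal.ofReal ((2 * n : ℝ)⁻¹ ^ p) ≤ singularValue S j ^ p := by
    intro j hj
    rw [← ENNReal.ofReal_rpow_of_pos (by positivity)]
    refine ENNReal.rpow_le_rpow (le_iInf₂ fun R hR => ?_) hp.le
    obtain ⟨v, hv0, hRv, -⟩ := exists_ne_zero_of_rank_le e ⟨j, Finset.mem_range.1 hj⟩
      (R : lp (fun _ : Fin n => ℂ) 2 →ₗ[ℂ] lp (fun _ : Fin n => ℂ) 2) hR
    rw [← ofReal_norm]
    refine ENNReal.ofReal_le_ofReal ?_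
    have h1 := norm_le_mul_norm_of_hasMatrix_chiMatrix hn0 hS v
    have h2 : S v = (S - R) v := by
      have : R v = 0 := hRv
      rw [sub_apply, this, sub_zero]
    have h3 := (S - R).le_opNorm v
    rw [← h2] at h3
    have hv : 0 < ‖v‖ := norm_pos_iff.2 hv0
    have h4 : 1 * ‖v‖ ≤ (2 * n * ‖S - R‖) * ‖v‖ := by
      rw [one_mul, mul_assoc (2 * (n : ℝ))]
      exact h1.trans (mul_le_mul_of_nonneg_left h3 (by positivity))
    have h5 := le_of_mul_le_mul_right h4 hv
    rwa [inv_le_iff_one_le_mul₀' (by positivity)]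
  have hsum : ENNReal.ofReal (n * (2 * n : ℝ)⁻¹ ^ p) ≤ ∑' j, singularValue S j ^ p := by
    refine le_trans ?_ (ENNReal.sum_le_tsum (Finset.range n))
    refine le_trans ?_ (Finset.sum_le_sum hs)
    rw [Finset.sum_const, Finset.card_range, nsmul_eq_mul, ENNReal.ofReal_mul hn0.le,
      ENNReal.ofReal_natCast]
  refine le_trans (le_of_eq ?_) (ENNReal.rpow_le_rpow hsum (show 0 ≤ 1 / p by positivity))
  rw [ENNReal.ofReal_rpow_of_nonneg (by positivity) (by positivity)]
  congr 1
  rw [Real.mul_rpow hn0.le (by positivity), ← Real.rpow_mul (by positivity),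
    mul_one_div_cancel hp.ne', Real.rpow_one, Real.rpow_sub hn0, Real.rpow_one]
  field_simp

end Lower

theorem theorem6p1 (p : ℝ) (hp0 : 0 < p) (hp1 : p < 1) :
    ∃ c C : ℝ, 0 < c ∧ 0 < C ∧ ∀ n : ℕ, 1 ≤ n →
      ENNReal.ofReal (c * (n : ℝ) ^ (1 / p - 1)) ≤ schurMultiplierNorm p (chiMatrix n) ∧
      transformerNorm p (triangularProjection n) = schurMultiplierNorm p (chiMatrix n) ∧
      schurMultiplierNorm p (chiMatrix n) = schurMultiplierNorm p (deltaMatrix n) ∧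
      schurMultiplierNorm p (deltaMatrix n) ≤ ENNReal.ofReal (C * (n : ℝ) ^ (1 / p - 1)) := by
  have hq : (1 : ℝ) < 2 ^ (1 - p) := Real.one_lt_rpow one_lt_two (by linarith)
  refine ⟨1 / 2, ((2 ^ (1 - p)) ^ 2 / (2 ^ (1 - p) - 1)) ^ (1 / p), by norm_num,
    Real.rpow_pos_of_pos (div_pos (by positivity) (by linarith)) _, fun n hn =>
      ⟨le_schurMultiplierNorm_chiMatrix hn hp0, transformerNorm_triangularProjection n p,
        schurMultiplierNorm_chiMatrix_eq_deltaMatrix n hp0, ?_⟩⟩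
  rw [← schurMultiplierNorm_chiMatrix_eq_deltaMatrix n hp0]
  exact schurMultiplierNorm_chiMatrix_le hn hp0 hp1
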